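/- \textbf{Conventions.} Fix a signature with arbitrarily many relation symbols but only countably many function and constant symbols. All structures are structures over this signature (the empty structure is allowed if there are no constants), and an embedding is an injective homomorphism that also reflects relations. The age of a structure $\mathbf{A}$ is the class of all finitely generated structures that embed into $\mathbf{A}$. A \emph{Fra\"iss\'e class} is a non-empty class of finitely generated structures, closed under isomorphism, that has only countably many isomorphism types, the hereditary property, the joint embedding property and the amalgamation property. For such a class $\mathcal{K}$, let $\overline{\mathcal{K}}$ be the class of all countable structures whose age is contained in $\mathcal{K}$, and let $(\overline{\mathcal{K}},\to)$ be the category of these structures with all homomorphisms. A Fra\"iss\'e class $\mathcal{U}$ is \emph{strict} if for all $\mathbf{A},\mathbf{B}_1,\mathbf{B}_2\in\mathcal{U}$ and all embeddings $f_1:\mathbf{A}\hookrightarrow\mathbf{B}_1$, $f_2:\mathbf{A}\hookrightarrow\mathbf{B}_2$ there are $\mathbf{Q}\in\mathcal{U}$ and homomorphisms $g_1:\mathbf{B}_1\to\mathbf{Q}$, $g_2:\mathbf{B}_2\to\mathbf{Q}$ such that $(\mathbf{Q},g_1,g_2)$ is a pushout of $f_1,f_2$ in $(\overline{\mathcal{U}},\to)$.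 A Fra\"iss\'e class $\mathcal{C}\subseteq\mathcal{U}$ is \emph{free in} $\mathcal{U}$ if for all $\mathbf{A},\mathbf{B}_1,\mathbf{B}_2\in\mathcal{C}$ and all embeddings $f_1:\mathbf{A}\hookrightarrow\mathbf{B}_1$, $f_2:\mathbf{A}\hookrightarrow\mathbf{B}_2$, every $\mathbf{Q}\in\mathcal{U}$ that is a pushout of $f_1,f_2$ in $(\overline{\mathcal{U}},\to)$ belongs to $\mathcal{C}$. Let $\mathbf{T}$ be a countable structure. A \emph{universal homogeneous homomorphism} to $\mathbf{T}$ within $\overline{\mathcal{C}}$ is a homomorphism $u:\mathbf{U}\to\mathbf{T}$ with $\mathbf{U}\in\overline{\mathcal{C}}$ such that (i) for every $\mathbf{A}\in\overline{\mathcal{C}}$ and every homomorphism $h:\mathbf{A}\to\mathbf{T}$ there is an embedding $\iota:\mathbf{A}\hookrightarrow\mathbf{U}$ with $h=u\circ\iota$, and (ii) for every finitely generated substructure $\mathbf{A}\le\mathbf{U}$ and every embedding $\iota:\mathbf{A}\hookrightarrow\mathbf{U}$ with $u\circ\iota=u|_{A}$ there is an automorphism $\alpha$ of $\mathbf{U}$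 with $u\circ\alpha=u$ and $\alpha|_{A}=\iota$. \textbf{Theorem.} Let $\mathcal{U}$ be a strict Fra\"iss\'e class, let $\mathbf{T}\in\overline{\mathcal{U}}$, and let $\mathcal{C}\subseteq\mathcal{U}$ be a Fra\"iss\'e class that is free in $\mathcal{U}$. Then there exists a universal homogeneous homomorphism $u:\mathbf{U}\to\mathbf{T}$ within $\overline{\mathcal{C}}$. Moreover, if $u:\mathbf{U}\to\mathbf{T}$ and $\hat{u}:\hat{\mathbf{U}}\to\mathbf{T}$ are any two universal homogeneous homomorphisms within $\overline{\mathcal{C}}$, then there exists an isomorphism $h:\hat{\mathbf{U}}\to\mathbf{U}$ such that $\hat{u}=u\circ h$. -/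

import Mathlib

open CategoryTheory FirstOrder

universe u v w

namespace UnivHomogHom

variable {L : FirstOrder.Language.{u, v}}

/-- The class of all countable structures whose age is contained in `K`
(usually written `K` with a bar). -/
def younger (K : Set (Bundled.{w} L.Structure)) : Set (Bundled.{w} L.Structure) :=
  {M | Countable M ∧ L.age M ⊆ K}

/-- The square `g₁ ∘ f₁ = g₂ ∘ f₂`, with corner `Q`, is a pushout square in the category whose
objects are the structures in `D` and whose morphisms are all homomorphisms between them. -/
def IsPushoutSquare (D : Set (Bundled.{w} L.Structure)) {A B₁ B₂ Q : Bundled.{w} L.Structure}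
    (f₁ : A →[L] B₁) (f₂ : A →[L] B₂) (g₁ : B₁ →[L] Q) (g₂ : B₂ →[L] Q) : Prop :=
  A ∈ D ∧ B₁ ∈ D ∧ B₂ ∈ D ∧ Q ∈ D ∧ g₁.comp f₁ = g₂.comp f₂ ∧
    ∀ X ∈ D, ∀ (h₁ : B₁ →[L] X) (h₂ : B₂ →[L] X), h₁.comp f₁ = h₂.comp f₂ →
      ∃! m : Q →[L] X, m.comp g₁ = h₁ ∧ m.comp g₂ = h₂

/-- The strict amalgamation property of a class `K`: any two embeddings `f₁ : A ↪ B₁`,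
`f₂ : A ↪ B₂` inside `K` have a pushout in `(younger K, →)` whose corner belongs to `K`. -/
def StrictAmalgamation (K : Set (Bundled.{w} L.Structure)) : Prop :=
  ∀ A ∈ K, ∀ B₁ ∈ K, ∀ B₂ ∈ K, ∀ (f₁ : A ↪[L] B₁) (f₂ : A ↪[L] B₂),
    ∃ Q ∈ K, ∃ (g₁ : B₁ →[L] Q) (g₂ : B₂ →[L] Q),
      IsPushoutSquare (younger K) f₁.toHom f₂.toHom g₁ g₂

/-- A strict Fraïssé class. -/
structure IsStrictFraisse (K : Set (Bundled.{w} L.Structure)) : Prop where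
  isFraisse : FirstOrder.Language.IsFraisse K
  strictAmalgamation : StrictAmalgamation K

/-- `C` is closed with respect to canonical amalgams in `K`: whenever `A, B₁, B₂ ∈ C` and `Q ∈ K`
is the corner of a pushout square in `(younger K, →)` over embeddings `A ↪ B₁`, `A ↪ B₂`,
then `Q ∈ C`. -/
def IsFreeIn (C K : Set (Bundled.{w} L.Structure)) : Prop :=
  ∀ A ∈ C, ∀ B₁ ∈ C, ∀ B₂ ∈ C, ∀ Q ∈ K, ∀ (f₁ : A ↪[L] B₁) (f₂ : A ↪[L] B₂)
    (g₁ : B₁ →[L] Q) (g₂ : B₂ →[L] Q),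
    IsPushoutSquare (younger K) f₁.toHom f₂.toHom g₁ g₂ → Q ∈ C

/-- `u : U → T` is universal within `younger C`. -/
def IsUniversalWithin (C : Set (Bundled.{w} L.Structure)) {U T : Bundled.{w} L.Structure}
    (u : U →[L] T) : Prop :=
  ∀ A ∈ younger C, ∀ h : A →[L] T, ∃ ι : A ↪[L] U, h = u.comp ι.toHom

/-- `u : U → T` is homogeneous: every embedding into `U` of a finitely generated substructure
of `U` that is compatible with `u` extends to an automorphism of `U` compatible with `u`. -/
def IsHomogeneousHom {U T : Bundled.{w} L.Structure} (u : U →[L] T) : Prop :=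
  ∀ A : L.Substructure U, A.FG → ∀ ι : A ↪[L] U, u.comp A.subtype.toHom = u.comp ι.toHom →
    ∃ α : U ≃[L] U, u.comp α.toHom = u ∧ ∀ a : A, α a = ι a

/-- `u : U → T` is a universal homogeneous homomorphism to `T` within `younger C`. -/
structure IsUniversalHomogeneousHom (C : Set (Bundled.{w} L.Structure))
    {U T : Bundled.{w} L.Structure} (u : U →[L] T) : Prop where
  mem : U ∈ younger C
  countable : Countable T
  universal : IsUniversalWithin C u
  homogeneous : IsHomogeneousHom u

end UnivHomogHom

namespace UnivHomogHom

/-! Everything passes through the extension property over `T` (`HasExtensionProperty`). A universal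
homogeneous homomorphism has it: universality embeds the larger structure, homogeneity corrects the
position. Conversely, going forth gives universality and back-and-forth over `T` gives homogeneity;
the same back-and-forth gives uniqueness. For existence, run Fraïssé's construction on members of
`C` equipped with homomorphisms to `T` (`ObjOver`). The crux is `ObjOver.amalgamation`: strictness
supplies a pushout, freeness puts it in `C`, and its universal property maps it to `T`. Countability
of `T` leaves only countably many extension tasks. -/

/-! ### Bookkeeping for countable chains -/

/-- Any object starts a countable chain along which each of countably many extension tasks
`A i ⟶ B i` is eventually solved, provided that each single task can be solved. -/
theorem exists_chain {X : Type*} [Category X] (x₀ : X) {I : Type*} [Countable I] (A B : I → X)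
    (f : ∀ i, A i ⟶ B i) (hA : ∀ i x, Countable (A i ⟶ x))
    (hf : ∀ i x (e : A i ⟶ x), ∃ (y : X) (g : x ⟶ y) (e' : B i ⟶ y), f i ≫ e' = e ≫ g) :
    ∃ F : ℕ ⥤ X, F.obj 0 = x₀ ∧ ∀ i n (e : A i ⟶ F.obj n),
      ∃ (m : ℕ) (h : n ≤ m) (e' : B i ⟶ F.obj m), f i ≫ e' = e ≫ F.map (homOfLE h) := by
  -- `none` is an idle task, so that every stage has a surjective enumeration by `ℕ`.
  let Task : X → Type _ := fun x => Option (Σ i, A i ⟶ x)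
  have hsolve : ∀ (x : X) (t : Task x), ∃ (y : X) (g : x ⟶ y), ∀ i (e : A i ⟶ x),
      t = some ⟨i, e⟩ → ∃ e' : B i ⟶ y, f i ≫ e' = e ≫ g := by
    rintro x (_ | ⟨i, e⟩)
    · exact ⟨x, 𝟙 x, fun i e h => by cases h⟩
    · obtain ⟨y, g, e', h⟩ := hf i x e
      refine ⟨y, g, fun i' e₁ h₁ => ?_⟩
      cases h₁
      exact ⟨e', h⟩
  choose Y g hg using hsolve
  have henum : ∀ x, ∃ s : ℕ → Task x, Function.Surjective s := fun x => by
    have : Countable (Task x) := inferInstanceAs (Countable (Option (Σ i, A i ⟶ x)))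
    have : Nonempty (Task x) := ⟨none⟩
    exact exists_surjective_nat _
  choose enum enum_surj using henum
  -- Row `i` holds the tasks born at stage `i`, pushed forward to the current object. Rows beyond
  -- `n` are placeholders, re-enumerated at the new object; row `n + 1` thereby becomes final.
  let step : ℕ → (Σ x, ℕ → ℕ → Task x) → Σ x, ℕ → ℕ → Task x := fun n s =>
    ⟨Y s.1 (s.2 n.unpair.1 n.unpair.2), fun i j =>
      if i ≤ n then (s.2 i j).map fun p => ⟨p.1, p.2 ≫ g s.1 (s.2 n.unpair.1 n.unpair.2)⟩ else enum _ j⟩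
  let st : ℕ → Σ x, ℕ → ℕ → Task x := fun n =>
    Nat.rec ⟨x₀, fun _ => enum x₀⟩ step n
  let k : ∀ n, (st n).1 ⟶ (st (n + 1)).1 := fun n => g _ _
  have hst : ∃ (G : ℕ → X) (k : ∀ n, G n ⟶ G (n + 1)) (t : ∀ n, ℕ → ℕ → Task (G n)), G 0 = x₀ ∧
      (∀ n i (e : A i ⟶ G n), ∃ j, t n n j = some ⟨i, e⟩) ∧
      (∀ m i j, i ≤ m → t (m + 1) i j = (t m i j).map fun p => ⟨p.1, p.2 ≫ k m⟩) ∧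
      ∀ n i (e : A i ⟶ G n), t n n.unpair.1 n.unpair.2 = some ⟨i, e⟩ →
        ∃ e' : B i ⟶ G (n + 1), f i ≫ e' = e ≫ k n := by
    refine ⟨fun n => (st n).1, fun n => g _ _, fun n => (st n).2, rfl, fun n i e => ?_,
      fun m i j h => if_pos h, fun n i e => hg _ _ i e⟩
    obtain ⟨j, hj⟩ := enum_surj (st n).1 (some ⟨i, e⟩)
    refine ⟨j, Eq.trans ?_ hj⟩
    rcases n with _ | n
    · rfl
    · exact if_neg (by omega)
  obtain ⟨G, k, t, h₀, ht, hpush, hsol⟩ := hst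
  let K : ∀ n m, n ≤ m → (G n ⟶ G m) := fun n m h => (Functor.ofSequence k).map (homOfLE h)
  have hK : ∀ n m (h : n ≤ m), K n (m + 1) (h.trans m.le_succ) = K n m h ≫ k m := by
    intro n m h
    have h₁ : K m (m + 1) m.le_succ = k m := Functor.ofSequence_map_homOfLE_succ k m
    rw [← h₁]
    exact (Functor.ofSequence k).map_comp (homOfLE h) (homOfLE m.le_succ)
  have hKt : ∀ n j i (e : A i ⟶ G n), t n n j = some ⟨i, e⟩ → ∀ m (h : n ≤ m),
      t m n j = some ⟨i, e ≫ K n m h⟩ := by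
    intro n j i e he m h
    induction m, h using Nat.le_induction with
    | base =>
      have h₁ : K n n le_rfl = 𝟙 _ := (Functor.ofSequence k).map_id n
      rw [he, h₁, Category.comp_id]
    | succ m h ih => rw [hpush m n j h, ih, Option.map_some, hK n m h, Category.assoc]
  refine ⟨Functor.ofSequence k, h₀, fun i n (e : A i ⟶ G n) => ?_⟩
  obtain ⟨j, hj⟩ := ht n i e
  -- Task `j` of stage `n` comes up at stage `Nat.pair n j`, never before its birth.
  have hle : n ≤ Nat.pair n j := Nat.left_le_pair n j
  obtain ⟨e', he'⟩ := hsol (Nat.pair n j) i (e ≫ K n _ hle)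
    (by simpa only [Nat.unpair_pair] using hKt n j i e hj _ hle)
  refine ⟨Nat.pair n j + 1, hle.trans (Nat.le_succ _), e', he'.trans ?_⟩
  rw [Category.assoc, ← hK n _ hle]
  rfl

open FirstOrder.Language

/-! ### Back-and-forth over `T` -/

section BackAndForth

variable {L : FirstOrder.Language.{u, v}} {M N : Type*} [L.Structure M] [L.Structure N]

/-- Partial equivalences with finitely generated domain along which `q` restricts to `p`. -/
abbrev FGEquivOver {T : Type*} (p : M → T) (q : N → T) :=
  {f : M ≃ₚ[L] N // f.dom.FG ∧ ∀ x : f.dom, q (f.toEquiv x) = p x}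

variable {T : Type*} {p : M → T} {q : N → T}

/-- The inverse of a partial equivalence over `T`. -/
def FGEquivOver.symm (f : FGEquivOver (L := L) p q) : FGEquivOver (L := L) q p :=
  ⟨f.1.symm, f.1.dom_fg_iff_cod_fg.1 f.2.1, fun x =>
    (f.2.2 (f.1.toEquiv.symm x)).symm.trans
      (congrArg (fun y : f.1.cod => q y) (f.1.toEquiv.apply_symm_apply x))⟩

variable (L p q) in
/-- Every partial equivalence over `T` extends to any further element of its domain. -/
def IsExtensionPairOver : Prop :=
  ∀ (f : FGEquivOver (L := L) p q) (m : M), ∃ g : FGEquivOver (L := L) p q, m ∈ g.1.dom ∧ f ≤ g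

/-- The partial equivalence over `T` given by an embedding of a finitely generated substructure. -/
noncomputable def FGEquivOver.ofEmbedding (S : L.Substructure M) (hS : S.FG) (e : S ↪[L] N)
    (he : ∀ x : S, q (e x) = p x) : FGEquivOver (L := L) p q :=
  ⟨⟨S, e.toHom.range, e.equivRange⟩, hS, he⟩

/-- Containing a given point in the domain or codomain is a cofinal condition; an increasing
sequence meeting these countably many conditions has a total limit. -/
theorem exists_equiv_over [Countable M] [Countable N] (f₀ : FGEquivOver (L := L) p q)
    (hMN : IsExtensionPairOver L p q) (hNM : IsExtensionPairOver L q p) :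
    ∃ e : M ≃[L] N, (∀ m, q (e m) = p m) ∧ ∀ x : f₀.1.dom, e x = f₀.1.toEquiv x := by
  have _ : Encodable M := Encodable.ofCountable _
  have _ : Encodable N := Encodable.ofCountable _
  let D : M ⊕ N → Order.Cofinal (FGEquivOver (L := L) p q) := fun s =>
    Sum.rec (fun m => ⟨{f | m ∈ f.1.dom}, fun f => hMN f m⟩)
      (fun n => ⟨{f | n ∈ f.1.cod}, fun f => by
        obtain ⟨g, hg, hfg⟩ := hNM f.symm n
        exact ⟨g.symm, hg, PartialEquiv.monotone_symm hfg⟩⟩) s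
  let S : ℕ →o M ≃ₚ[L] N :=
    ⟨Subtype.val ∘ Order.sequenceOfCofinals f₀ D,
      (Subtype.mono_coe _).comp (Order.sequenceOfCofinals.monotone _ _)⟩
  let F := DirectLimit.partialEquivLimit S
  have hdom : ∀ m, ∃ i, m ∈ (S i).dom := fun m =>
    ⟨_, Order.sequenceOfCofinals.encode_mem f₀ D (Sum.inl m)⟩
  have hcod : ∀ n, ∃ i, n ∈ (S i).cod := fun n =>
    ⟨_, Order.sequenceOfCofinals.encode_mem f₀ D (Sum.inr n)⟩
  have hS : ∀ i, S i ≤ F := DirectLimit.le_partialEquivLimit S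
  have dom_top : F.dom = ⊤ := top_le_iff.1 fun m _ => by
    obtain ⟨i, hi⟩ := hdom m
    exact PartialEquiv.dom_le_dom (hS i) hi
  have cod_top : F.cod = ⊤ := top_le_iff.1 fun n _ => by
    obtain ⟨i, hi⟩ := hcod n
    exact PartialEquiv.cod_le_cod (hS i) hi
  have happ : ∀ i (x : (S i).dom), PartialEquiv.toEquivOfEqTop dom_top cod_top x =
      ((S i).toEquiv x : N) := fun i x => by
    have h₁ : (PartialEquiv.toEquivOfEqTop dom_top cod_top).toEmbedding (x : M) = _ :=
      DFunLike.congr_fun (PartialEquiv.toEquivOfEqTop_toEmbedding dom_top cod_top) (x : M)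
    rw [PartialEquiv.toEmbeddingOfEqTop_apply] at h₁
    refine h₁.trans ?_
    have := PartialEquiv.toEquiv_inclusion_apply (hS i) x
    exact congrArg Subtype.val this
  refine ⟨PartialEquiv.toEquivOfEqTop dom_top cod_top, fun m => ?_, happ 0⟩
  obtain ⟨i, hi⟩ := hdom m
  rw [happ i ⟨m, hi⟩]
  exact (Order.sequenceOfCofinals f₀ D i).2.2 ⟨m, hi⟩

theorem exists_embedding_over [Countable M] (f₀ : FGEquivOver (L := L) p q)
    (hMN : IsExtensionPairOver L p q) : ∃ e : M ↪[L] N, ∀ m, q (e m) = p m := by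
  have _ : Encodable M := Encodable.ofCountable _
  let D : M → Order.Cofinal (FGEquivOver (L := L) p q) := fun m =>
    ⟨{f | m ∈ f.1.dom}, fun f => hMN f m⟩
  let S : ℕ →o M ≃ₚ[L] N :=
    ⟨Subtype.val ∘ Order.sequenceOfCofinals f₀ D,
      (Subtype.mono_coe _).comp (Order.sequenceOfCofinals.monotone _ _)⟩
  let F := DirectLimit.partialEquivLimit S
  have hdom : ∀ m, ∃ i, m ∈ (S i).dom := fun m =>
    ⟨_, Order.sequenceOfCofinals.encode_mem f₀ D m⟩
  have hS : ∀ i, S i ≤ F := DirectLimit.le_partialEquivLimit S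
  have dom_top : F.dom = ⊤ := top_le_iff.1 fun m _ => by
    obtain ⟨i, hi⟩ := hdom m
    exact PartialEquiv.dom_le_dom (hS i) hi
  refine ⟨PartialEquiv.toEmbeddingOfEqTop dom_top, fun m => ?_⟩
  obtain ⟨i, hi⟩ := hdom m
  rw [PartialEquiv.toEmbeddingOfEqTop_apply]
  have h₁ := congrArg Subtype.val (PartialEquiv.toEquiv_inclusion_apply (hS i) ⟨m, hi⟩)
  exact (congrArg q h₁).trans ((Order.sequenceOfCofinals f₀ D i).2.2 ⟨m, hi⟩)

/-- An embedding whose range lies in the range of another one factors through it. -/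
theorem exists_embedding_comp_eq {R : Type*} [L.Structure R] (f : M ↪[L] R) (g : N ↪[L] R)
    (h : ∀ m, f m ∈ g.toHom.range) : ∃ k : M ↪[L] N, ∀ m, g (k m) = f m := by
  refine ⟨g.equivRange.symm.toEmbedding.comp (f.codRestrict g.toHom.range h), fun m => ?_⟩
  have := g.equivRange.apply_symm_apply (f.codRestrict g.toHom.range h m)
  exact congrArg Subtype.val this

/-- A homomorphism that becomes an embedding after composition with another one is an embedding. -/
def embeddingOfComp {R : Type*} [L.Structure R] (g : M →[L] N) (m : N →[L] R) (e : M ↪[L] R)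
    (h : ∀ x, m (g x) = e x) : M ↪[L] N where
  toFun := g
  inj' x y hxy := e.injective (by rw [← h, ← h]; exact congrArg m hxy)
  map_fun' := g.map_fun
  map_rel' r x := by
    refine ⟨fun hr => ?_, g.map_rel r x⟩
    have h₁ := m.map_rel r _ hr
    rw [← e.map_rel]
    convert h₁ using 1
    exact funext fun i => (h (x i)).symm

end BackAndForth

/-! ### Maps out of and into direct limits -/

section DirectLimitHom

variable {L : FirstOrder.Language.{u, v}} {ι : Type*} [Preorder ι] [IsDirectedOrder ι] [Nonempty ι]
  {G : ι → Type*} [∀ i, L.Structure (G i)] (f : ∀ i j, i ≤ j → G i ↪[L] G j)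
  [DirectedSystem G fun i j h => f i j h] {P : Type*} [L.Structure P]

/-- Compatible homomorphisms out of the members of a directed system induce a homomorphism out of
the direct limit. -/
noncomputable def directLimitHom (g : ∀ i, G i →[L] P)
    (hg : ∀ i j hij x, g j (f i j hij x) = g i x) : Language.DirectLimit G f →[L] P where
  toFun := Quotient.lift (fun x : Structure.Sigma f => (g x.1) x.2) fun x y xy => by
    obtain ⟨i, hx, hy⟩ := directed_of (· ≤ ·) x.1 y.1
    rw [← hg x.1 i hx, ← hg y.1 i hy]
    exact congr_arg _ ((DirectLimit.equiv_iff ..).1 xy)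
  map_fun' F x := by
    obtain ⟨i, y, rfl⟩ := DirectLimit.exists_quotient_mk'_sigma_mk'_eq G f x
    exact (congrArg _ ((DirectLimit.of L ι G f i).map_fun F y).symm).trans ((g i).map_fun F y)
  map_rel' R x hx := by
    obtain ⟨i, y, rfl⟩ := DirectLimit.exists_quotient_mk'_sigma_mk'_eq G f x
    exact (g i).map_rel R y (((DirectLimit.of L ι G f i).map_rel R y).1 hx)

/-- An embedding of a finitely generated structure into a direct limit factors through a member
of the directed system. -/
theorem exists_factor_directLimit {A : Type*} [L.Structure A] (hA : Structure.FG L A)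
    (e : A ↪[L] Language.DirectLimit G f) :
    ∃ (i : ι) (k : A ↪[L] G i), ∀ a, DirectLimit.of L ι G f i (k a) = e a := by
  obtain ⟨i, S, hS⟩ := DirectLimit.exists_fg_substructure_in_Sigma e.toHom.range (hA.range _)
  obtain ⟨k, hk⟩ := exists_embedding_comp_eq e (DirectLimit.of L ι G f i) fun a => by
    have h : e a ∈ S.map (DirectLimit.of L ι G f i).toHom := hS ▸ ⟨a, rfl⟩
    exact Hom.map_le_range h
  exact ⟨i, k, hk⟩

end DirectLimitHom

/-! ### The extension property and its consequences -/

variable {L : FirstOrder.Language.{u, v}} {C : Set (Bundled.{w} L.Structure)}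

/-- Every embedding over `T` of a member of `C` into `U` extends along embeddings over `T`
between members of `C`. -/
def HasExtensionProperty (C : Set (Bundled.{w} L.Structure)) {U T : Bundled.{w} L.Structure}
    (u : U →[L] T) : Prop :=
  ∀ A ∈ C, ∀ B ∈ C, ∀ (f : A ↪[L] B) (e : A ↪[L] U) (b : B →[L] T), (∀ a, u (e a) = b (f a)) →
    ∃ e' : B ↪[L] U, (∀ a, e' (f a) = e a) ∧ ∀ x, u (e' x) = b x

theorem mem_of_fg {M : Bundled.{w} L.Structure} (hM : M ∈ younger C) {S : L.Substructure M}
    (hS : S.FG) : Bundled.mk S ∈ C :=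
  hM.2 ⟨S.fg_iff_structure_fg.1 hS, ⟨S.subtype⟩⟩

theorem mem_younger [Countable (Σ n, L.Functions n)] (hC : IsFraisse C)
    {M : Bundled.{w} L.Structure} (hM : M ∈ C) : M ∈ younger C :=
  ⟨Structure.cg_iff_countable.1 (hC.FG M hM).cg, hC.hereditary M hM⟩

/-- Adjoining one generator to a finitely generated domain is an inclusion between members of `C`.
-/
theorem HasExtensionProperty.isExtensionPairOver {U T X : Bundled.{w} L.Structure}
    {u : U →[L] T} (hu : HasExtensionProperty C u) (hX : X ∈ younger C) (h : X →[L] T) :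
    IsExtensionPairOver L h u := by
  intro f m
  have hS : (f.1.dom ⊔ Substructure.closure L {m}).FG :=
    f.2.1.sup (Substructure.fg_closure_singleton m)
  obtain ⟨e', he', hue'⟩ := hu _ (mem_of_fg hX f.2.1) _ (mem_of_fg hX hS)
    (Substructure.inclusion le_sup_left) f.1.toEmbedding
    (h.comp (Substructure.subtype _).toHom) f.2.2
  refine ⟨.ofEmbedding _ hS e' hue',
    (le_sup_right : Substructure.closure L {m} ≤ f.1.dom ⊔ _)
      (Substructure.subset_closure (Set.mem_singleton m)), le_sup_left, ?_⟩
  ext x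
  exact he' x

theorem HasExtensionProperty.isHomogeneousHom {U T : Bundled.{w} L.Structure} {u : U →[L] T}
    (hu : HasExtensionProperty C u) (hU : U ∈ younger C) : IsHomogeneousHom u := by
  intro A hA ι hι
  have := hU.1
  obtain ⟨α, hα, hαι⟩ := exists_equiv_over (p := u) (q := u)
    (.ofEmbedding A hA ι fun x => (DFunLike.congr_fun hι x).symm)
    (hu.isExtensionPairOver hU u) (hu.isExtensionPairOver hU u)
  exact ⟨α, Hom.ext hα, hαι⟩

theorem IsUniversalHomogeneousHom.hasExtensionProperty [Countable (Σ n, L.Functions n)]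
    (hC : IsFraisse C) {U T : Bundled.{w} L.Structure} {u : U →[L] T}
    (hu : IsUniversalHomogeneousHom C u) : HasExtensionProperty C u := by
  intro A hA B hB f e b hb
  obtain ⟨j, hj⟩ := hu.universal B (mem_younger hC hB) b
  have hju : ∀ x, u (j x) = b x := fun x => (DFunLike.congr_fun hj x).symm
  let r := (j.comp f).equivRange
  obtain ⟨α, hα, hαι⟩ := hu.homogeneous (j.comp f).toHom.range ((hC.FG A hA).range _)
    (e.comp r.symm.toEmbedding) (Hom.ext fun y => by
      obtain ⟨a, rfl⟩ := r.surjective y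
      change u (j (f a)) = u (e (r.symm (r a)))
      rw [r.symm_apply_apply, hju, hb])
  refine ⟨α.toEmbedding.comp j, fun a => ?_, fun x => ?_⟩
  · refine (hαι (r a)).trans ?_
    change e (r.symm (r a)) = e a
    rw [r.symm_apply_apply]
  · exact (DFunLike.congr_fun hα (j x)).trans (hju x)

theorem IsUniversalHomogeneousHom.exists_equiv [Countable (Σ n, L.Functions n)]
    (hC : IsFraisse C) {U U' T : Bundled.{w} L.Structure} {u : U →[L] T} {u' : U' →[L] T}
    (hu : IsUniversalHomogeneousHom C u) (hu' : IsUniversalHomogeneousHom C u') :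
    ∃ h : U' ≃[L] U, u' = u.comp h.toHom := by
  have := hu.mem.1
  have := hu'.mem.1
  obtain ⟨e, he⟩ := hu.universal _ (mem_younger hC (mem_of_fg hu'.mem Substructure.fg_bot))
    (u'.comp (Substructure.subtype ⊥).toHom)
  obtain ⟨h, hh, -⟩ := exists_equiv_over (p := u') (q := u)
    (.ofEmbedding ⊥ Substructure.fg_bot e fun x => (DFunLike.congr_fun he x).symm)
    ((hu.hasExtensionProperty hC).isExtensionPairOver hu'.mem u')
    ((hu'.hasExtensionProperty hC).isExtensionPairOver hu.mem u)
  exact ⟨h, Hom.ext fun x => (hh x).symm⟩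

/-- `⊥` is generated by the constants, which every substructure contains. This makes `⊥` a starting
point for back-and-forth. -/
theorem substructure_bot_eq_top {M : Type*} [L.Structure M]
    (S : L.Substructure (⊥ : L.Substructure M)) : S = ⊤ := top_le_iff.1 fun x _ => by
  have hx : (⊥ : L.Substructure M) ≤ S.map (Substructure.subtype ⊥).toHom := bot_le
  obtain ⟨y, hy, hyx⟩ := hx x.2
  rwa [← Subtype.ext (a1 := y) (a2 := x) hyx]

theorem hom_bot_apply_eq {M N : Type*} [L.Structure M] [L.Structure N]
    (f g : (⊥ : L.Substructure M) →[L] N) (x : (⊥ : L.Substructure M)) : f x = g x :=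
  (substructure_bot_eq_top (f.eqLocus g) ▸ Substructure.mem_top x : x ∈ f.eqLocus g)

/-- In a joint extension, the preimage in `⊥` of the image of `N` is a substructure, hence all of
`⊥`. -/
theorem nonempty_bot_embedding (hC : JointEmbedding C) {M N : Bundled.{w} L.Structure}
    (hM : Bundled.mk (⊥ : L.Substructure M) ∈ C) (hN : N ∈ C) :
    Nonempty ((⊥ : L.Substructure M) ↪[L] N) := by
  obtain ⟨R, -, ⟨e⟩, ⟨e'⟩⟩ := hC _ hM N hN
  obtain ⟨k, -⟩ := exists_embedding_comp_eq e e' fun x =>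
    (substructure_bot_eq_top (e'.toHom.range.comap e.toHom) ▸ Substructure.mem_top x :
      x ∈ e'.toHom.range.comap e.toHom)
  exact ⟨k⟩

theorem HasExtensionProperty.isUniversalWithin
    (hC : IsFraisse C) {U T : Bundled.{w} L.Structure}
    {u : U →[L] T} (hu : HasExtensionProperty C u) (hU : U ∈ younger C) :
    IsUniversalWithin C u := by
  intro X hX h
  have := hX.1
  have hUb := mem_of_fg hU Substructure.fg_bot
  have hXb := mem_of_fg hX Substructure.fg_bot
  obtain ⟨k⟩ := nonempty_bot_embedding hC.jointEmbedding hUb hXb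
  obtain ⟨e, -, he⟩ := hu _ hUb _ hXb k (Substructure.subtype ⊥)
    (h.comp (Substructure.subtype ⊥).toHom)
    (hom_bot_apply_eq (u.comp (Substructure.subtype ⊥).toHom)
      ((h.comp (Substructure.subtype ⊥).toHom).comp k.toHom))
  obtain ⟨ι, hι⟩ := exists_embedding_over (p := h) (q := u)
    (.ofEmbedding ⊥ Substructure.fg_bot e he) (hu.isExtensionPairOver hX h)
  exact ⟨ι, Hom.ext fun x => (hι x).symm⟩

/-! ### Fraïssé's construction over `T` -/

variable {T : Bundled.{w} L.Structure}

variable (C T) in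
/-- A member of `C` with a homomorphism to `T`. -/
structure ObjOver where
  left : Bundled.{w} L.Structure
  mem : left ∈ C
  hom : left →[L] T

/-- Embeddings over `T`. -/
instance : Category (ObjOver C T) where
  Hom A B := {e : A.left ↪[L] B.left // ∀ a, B.hom (e a) = A.hom a}
  id A := ⟨Embedding.refl L A.left, fun _ => rfl⟩
  comp f g := ⟨g.1.comp f.1, fun a => (g.2 _).trans (f.2 a)⟩

theorem ObjOver.amalgamation [Countable (Σ n, L.Functions n)] {K : Set (Bundled.{w} L.Structure)}
    (hK : IsStrictFraisse K) (hT : T ∈ younger K) (hC : IsFraisse C) (hsub : C ⊆ K)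
    (hfree : IsFreeIn C K) {A B₁ B₂ : ObjOver C T} (f₁ : A ⟶ B₁) (f₂ : A ⟶ B₂) :
    ∃ (Q : ObjOver C T) (g₁ : B₁ ⟶ Q) (g₂ : B₂ ⟶ Q), f₁ ≫ g₁ = f₂ ≫ g₂ := by
  obtain ⟨Q, hQ, g₁, g₂, hpo⟩ := hK.strictAmalgamation _ (hsub A.mem) _ (hsub B₁.mem) _
    (hsub B₂.mem) f₁.1 f₂.1
  have hQC : Q ∈ C := hfree _ A.mem _ B₁.mem _ B₂.mem Q hQ f₁.1 f₂.1 g₁ g₂ hpo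
  obtain ⟨-, -, -, -, hcomm, huniv⟩ := hpo
  obtain ⟨q, ⟨hq₁, hq₂⟩, -⟩ := huniv T hT B₁.hom B₂.hom
    (Hom.ext fun a => (f₁.2 a).trans (f₂.2 a).symm)
  -- Pushout legs are a priori only homomorphisms. Any ordinary amalgam `R` factors through the
  -- pushout, which forces them to be embeddings.
  obtain ⟨R, e₁, e₂, hR, he⟩ := hC.amalgamation _ _ _ f₁.1 f₂.1 A.mem B₁.mem B₂.mem
  obtain ⟨m, ⟨hm₁, hm₂⟩, -⟩ := huniv R (mem_younger hK.isFraisse (hsub hR)) e₁.toHom e₂.toHom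
    (Hom.ext fun a => DFunLike.congr_fun he a)
  refine ⟨⟨Q, hQC, q⟩, ⟨embeddingOfComp g₁ m e₁ (DFunLike.congr_fun hm₁), DFunLike.congr_fun hq₁⟩,
    ⟨embeddingOfComp g₂ m e₂ (DFunLike.congr_fun hm₂), DFunLike.congr_fun hq₂⟩, ?_⟩
  exact Subtype.ext (Embedding.ext fun a => DFunLike.congr_fun hcomm a)

theorem ObjOver.countable_hom [Countable (Σ n, L.Functions n)] (hC : IsFraisse C)
    (A B : ObjOver C T) : Countable (A ⟶ B) := by
  have := hC.FG _ A.mem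
  have : Countable B.left := (mem_younger hC B.mem).1
  exact inferInstanceAs (Countable {e : A.left ↪[L] B.left // _})

/-- A class with countably many isomorphism types has a countable family of representatives. -/
theorem exists_representatives (hC : IsFraisse C) :
    ∃ M : ℕ → Bundled.{w} L.Structure,
      (∀ i, M i ∈ C) ∧ ∀ N ∈ C, ∃ i, Nonempty (N ≃[L] M i) := by
  obtain ⟨F, hF⟩ := hC.is_essentially_countable.exists_eq_range (hC.is_nonempty.image _)
  have hFC : ∀ i, ∃ M ∈ C, Quotient.mk' M = F i := fun i =>
    (hF ▸ Set.mem_range_self i : F i ∈ Quotient.mk' '' C)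
  choose M hMC hM using hFC
  refine ⟨M, hMC, fun N hN => ?_⟩
  obtain ⟨i, hi⟩ : Quotient.mk' N ∈ Set.range F := hF ▸ Set.mem_image_of_mem _ hN
  exact ⟨i, Quotient.exact (hi.symm.trans (hM i).symm)⟩

theorem ObjOver.nonempty [Countable (Σ n, L.Functions n)]
    {K : Set (Bundled.{w} L.Structure)} (hK : IsFraisse K) (hT : T ∈ younger K)
    (hC : IsFraisse C) (hsub : C ⊆ K) : Nonempty (ObjOver C T) := by
  obtain ⟨M, hM⟩ := hC.is_nonempty
  have hMb := mem_of_fg (mem_younger hC hM) Substructure.fg_bot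
  obtain ⟨k⟩ := nonempty_bot_embedding hK.jointEmbedding (hsub hMb)
    (mem_of_fg hT Substructure.fg_bot)
  exact ⟨_, hMb, (Substructure.subtype ⊥).toHom.comp k.toHom⟩

instance (F : ℕ ⥤ ObjOver C T) : DirectedSystem (fun n => (F.obj n).left)
    fun _ _ h => (F.map (homOfLE h)).1 where
  map_self n x := by
    have : F.map (homOfLE le_rfl) = 𝟙 (F.obj n) := F.map_id n
    rw [this]
    rfl
  map_map i j k hij hjk x := by
    have : F.map (homOfLE (hij.trans hjk)) = F.map (homOfLE hij) ≫ F.map (homOfLE hjk) :=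
      F.map_comp (homOfLE hij) (homOfLE hjk)
    rw [this]
    rfl

theorem exists_hasExtensionProperty [Countable (Σ n, L.Functions n)]
    {K : Set (Bundled.{w} L.Structure)} (hK : IsStrictFraisse K) (hT : T ∈ younger K)
    (hC : IsFraisse C) (hsub : C ⊆ K) (hfree : IsFreeIn C K) :
    ∃ (U : Bundled.{w} L.Structure) (u : U →[L] T), U ∈ younger C ∧ HasExtensionProperty C u := by
  have := hT.1
  obtain ⟨A₀⟩ := ObjOver.nonempty hK.isFraisse hT hC hsub
  obtain ⟨M, hMC, hM⟩ := exists_representatives hC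
  have hIT : ∀ i, Countable (M i →[L] T) := fun i => (hC.FG _ (hMC i)).countable_hom T
  let J := Σ i, M i →[L] T
  let X : J → ObjOver C T := fun j => ⟨M j.1, hMC j.1, j.2⟩
  have hX : ∀ j j', Countable (X j ⟶ X j') := fun j j' => ObjOver.countable_hom hC _ _
  obtain ⟨F, -, hF⟩ := exists_chain A₀ (I := Σ j j', X j ⟶ X j') (fun t => X t.1)
    (fun t => X t.2.1) (fun t => t.2.2) (fun _ _ => ObjOver.countable_hom hC _ _) fun t x e => by
      obtain ⟨y, g₁, g₂, h⟩ := ObjOver.amalgamation hK hT hC hsub hfree t.2.2 e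
      exact ⟨y, g₂, g₁, h⟩
  let G : ℕ → Type w := fun n => (F.obj n).left
  let f : ∀ i j, i ≤ j → G i ↪[L] G j := fun i j h => (F.map (homOfLE h)).1
  let U : Bundled.{w} L.Structure := Bundled.mk (Language.DirectLimit G f)
  let u : U →[L] T := directLimitHom f (fun n => (F.obj n).hom)
    fun i j h x => (F.map (homOfLE h)).2 x
  refine ⟨U, u, ⟨?_, ?_⟩, ?_⟩
  · exact Structure.cg_iff_countable.1 (DirectLimit.cg f fun n => (hC.FG _ (F.obj n).mem).cg)
  · refine (age_directLimit G f).trans_subset ?_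
    exact Set.iUnion_subset fun n => hC.hereditary _ (F.obj n).mem
  intro A hA B hB φ e b hb
  obtain ⟨n, k, hk⟩ := exists_factor_directLimit f (hC.FG A hA) e
  obtain ⟨i, ⟨α⟩⟩ := hM A hA
  obtain ⟨j, ⟨β⟩⟩ := hM B hB
  -- `φ` transported to the chosen representatives, so that it is one of the countably many tasks
  -- solved along the chain.
  let s : X ⟨i, (b.comp φ.toHom).comp α.symm.toHom⟩ ⟶ X ⟨j, b.comp β.symm.toHom⟩ :=
    ⟨(β.toEmbedding.comp φ).comp α.symm.toEmbedding, fun a =>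
      congrArg b (β.symm_apply_apply (φ (α.symm a)))⟩
  have huk : ∀ a, (F.obj n).hom (k a) = b (φ a) := fun a => by
    rw [← hb, ← hk]
    rfl
  obtain ⟨m, hnm, e', he'⟩ := hF ⟨_, _, s⟩ n
    ⟨k.comp α.symm.toEmbedding, fun a => huk (α.symm a)⟩
  refine ⟨(DirectLimit.of L ℕ G f m).comp (e'.1.comp β.toEmbedding), fun a => ?_, fun x => ?_⟩
  · have h₁ : e'.1 (β (φ (α.symm (α a)))) = f n m hnm (k (α.symm (α a))) :=
      DFunLike.congr_fun (congrArg Subtype.val he') (α a)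
    rw [α.symm_apply_apply] at h₁
    change DirectLimit.of L ℕ G f m (e'.1 (β (φ a))) = e a
    rw [h₁, ← hk]
    exact DirectLimit.of_f
  · refine (e'.2 (β x)).trans ?_
    exact congrArg b (β.symm_apply_apply x)

end UnivHomogHom

theorem mainTheorem2 {L : FirstOrder.Language.{u, v}} [Countable (Σ n, L.Functions n)]
    (𝒰 : Set (Bundled.{w} L.Structure)) (h𝒰 : UnivHomogHom.IsStrictFraisse 𝒰)
    (T : Bundled.{w} L.Structure) (hT : T ∈ UnivHomogHom.younger 𝒰)
    (𝒞 : Set (Bundled.{w} L.Structure)) (h𝒞 : FirstOrder.Language.IsFraisse 𝒞) (hsub : 𝒞 ⊆ 𝒰)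
    (hfree : UnivHomogHom.IsFreeIn 𝒞 𝒰) :
    (∃ (U : Bundled.{w} L.Structure) (u : U →[L] T),
      UnivHomogHom.IsUniversalHomogeneousHom 𝒞 u) ∧
    ∀ (U U' : Bundled.{w} L.Structure) (u : U →[L] T) (u' : U' →[L] T),
      UnivHomogHom.IsUniversalHomogeneousHom 𝒞 u →
      UnivHomogHom.IsUniversalHomogeneousHom 𝒞 u' →
      ∃ h : U' ≃[L] U, u' = u.comp h.toHom := by
  refine ⟨?_, fun U U' u u' hu hu' => hu.exists_equiv h𝒞 hu'⟩
  obtain ⟨U, u, hU, hu⟩ := UnivHomogHom.exists_hasExtensionProperty h𝒰 hT h𝒞 hsub hfree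
  exact ⟨U, u, hU, hT.1, hu.isUniversalWithin h𝒞 hU, hu.isHomogeneousHom hU⟩
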